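/- Let $(\mathcal N,G)$ be a smooth Riemannian manifold without boundary, of finite dimension or modelled on a Hilbert space, with norm $\|v\|:=\sqrt{G(v,v)}$ on the tangent spaces and Levi-Civita connection $\nabla$. Let $U\subset\mathcal N$ be open and convex, in the sense that any two points of $U$ are joined by a geodesic that stays in $U$, and let $f:U\to\mathbb R$ be twice differentiable, with Riemannian gradient $\operatorname{grad} f$ and Riemannian Hessian $\operatorname{Hess} f(x)[h]:=\nabla_h\operatorname{grad} f$, $h\in T_x\mathcal N$. Let $\hat x\in U$. (a) If $\hat x$ is an optimal solution, i.e. a (local or global) minimizer of $f$ on $U$, then $G(\operatorname{Hess} f(\hat x)h,h)\ge 0$ for all $h\in T_{\hat x}\mathcal N$. (b) Suppose that $\operatorname{grad} f(\hat x)=0$; that $\operatorname{Hess} f(\hat x)$ is coercive, i.e. there is $c>0$ with $G(\operatorname{Hess} f(\hat x)h,h)\ge c\|h\|^2$ for all $h\in T_{\hat x}\mathcal N$; and that the Hessian satisfies the following Lipschitz condition at $\hat x$: there is a constant $L<\infty$ such that $$\|\mathcal P_{1,0}\operatorname{Hess} f(\exp_{\hat x}(\Delta x))\,\mathcal P_{0,1}-\operatorname{Hess}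 f(\hat x)\|\le L\|\Delta x\|$$ for all $\Delta x\in T_{\hat x}\mathcal N$ in the domain of $\exp_{\hat x}$ for which the geodesic $\gamma(t)=\exp_{\hat x}(t\Delta x)$, $t\in[0,1]$, stays in $U$, where $\mathcal P_{\alpha,\beta}:T_{\gamma(\alpha)}\mathcal N\to T_{\gamma(\beta)}\mathcal N$ is the parallel transport along $\gamma$ and the norm on the left is the operator norm. Then $\hat x$ is a local minimum of $f$ on $U$. -/

import Mathlib

noncomputable section

namespace RiemannianOpt

section

variable {E : Type*} [NormedAddCommGroup E] [NormedSpace ℝ E]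

/-- For a field `g` of bilinear forms on `E`, with `∂_a g` its derivative at `u` in direction `a`:
`koszulForm g u w v z = ½ (∂_v g(w, z) + ∂_w g(v, z) - ∂_z g(w, v))`. -/
def koszulForm (g : E → E →L[ℝ] E →L[ℝ] ℝ) (u w : E) : E →L[ℝ] E →L[ℝ] ℝ :=
  let D : E →L[ℝ] E →L[ℝ] E →L[ℝ] ℝ := fderiv ℝ g u
  (1 / 2 : ℝ) • (D.flip w + D w - (D.flip w).flip)

theorem koszulForm_apply (g : E → E →L[ℝ] E →L[ℝ] ℝ) (u w v z : E) :
    koszulForm g u w v z =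
      1 / 2 * (fderiv ℝ g u v w z + fderiv ℝ g u w v z - fderiv ℝ g u z w v) := rfl

end

end RiemannianOpt

end

open Set Bundle Manifold
open scoped ContDiff Topology

noncomputable section

/-! Throughout, `N` is a smooth manifold without boundary modelled on a Banach space `E` (of finite
or infinite dimension). A Riemannian metric on `N` is Mathlib's `RiemannianBundle` structure on the
tangent bundle: an inner product `inner ℝ v w` on every tangent space, with norm
`‖v‖ = √(inner ℝ v v)`, inducing the topology of the tangent space. -/

namespace RiemannianOpt

section

variable {E : Type*} [NormedAddCommGroup E] [NormedSpace ℝ E]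
  {N : Type*} [TopologicalSpace N] [ChartedSpace E N] [IsManifold 𝓘(ℝ, E) ∞ N]

/-- Coordinates of tangent vectors at `y` in the preferred chart around `p`. For `y` in the domain
of this chart it is the derivative of the chart at `y`, and for `y = p` it is the identity. -/
def coord (p y : N) : TangentSpace 𝓘(ℝ, E) y →L[ℝ] E :=
  (trivializationAt E (TangentSpace 𝓘(ℝ, E)) p).continuousLinearMapAt ℝ y

/-- The inverse of `coord p y`, for `y` in the domain of the preferred chart around `p`. -/
def coordInv (p y : N) : E →L[ℝ] TangentSpace 𝓘(ℝ, E) y :=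
  (trivializationAt E (TangentSpace 𝓘(ℝ, E)) p).symmL ℝ y

variable [RiemannianBundle (fun x : N ↦ TangentSpace 𝓘(ℝ, E) x)]

/-- A tangent space of a Riemannian manifold is complete, i.e. a Hilbert space. -/
theorem completeSpace_tangentSpace [CompleteSpace E] (x : N) :
    CompleteSpace (TangentSpace 𝓘(ℝ, E) x) := by
  let e : TangentSpace 𝓘(ℝ, E) x ≃L[ℝ] E :=
    (trivializationAt E (TangentSpace 𝓘(ℝ, E)) x).continuousLinearEquivAt ℝ x
      (FiberBundle.mem_baseSet_trivializationAt' x)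
  exact (completeSpace_congr (e := e.toEquiv) e.isUniformEmbedding).2 inferInstance

/-- The metric in the preferred chart around `p`: the Gram form `(v, w) ↦ g_u(v, w)` at the
coordinate point `u`. -/
def metricInChart (p : N) (u : E) : E →L[ℝ] E →L[ℝ] ℝ :=
  let y : N := (chartAt E p).symm u
  let g : TangentSpace 𝓘(ℝ, E) y →L[ℝ] TangentSpace 𝓘(ℝ, E) y →L[ℝ] ℝ := innerSL ℝ
  g.bilinearComp (coordInv p y) (coordInv p y)

variable [CompleteSpace E]

/-- The Riesz representative: `riesz x ℓ` is the vector `v` with `⟪v, w⟫ = ℓ w` for all `w`. -/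
def riesz (x : N) (l : TangentSpace 𝓘(ℝ, E) x →L[ℝ] ℝ) : TangentSpace 𝓘(ℝ, E) x :=
  haveI := completeSpace_tangentSpace (E := E) x
  (InnerProductSpace.toDual ℝ (TangentSpace 𝓘(ℝ, E) x)).symm l

/-- The Christoffel symbol `v ↦ Γ(v, w)` of the Levi-Civita connection at `p` in the preferred chart
around `p`, determined by `⟪Γ(v, w), z⟫ = ½ (∂_v g(w, z) + ∂_w g(v, z) - ∂_z g(v, w))`. -/
def christoffel (p : N) (w : TangentSpace 𝓘(ℝ, E) p) :
    TangentSpace 𝓘(ℝ, E) p →L[ℝ] TangentSpace 𝓘(ℝ, E) p :=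
  haveI := completeSpace_tangentSpace (E := E) p
  let B : TangentSpace 𝓘(ℝ, E) p →L[ℝ] TangentSpace 𝓘(ℝ, E) p →L[ℝ] ℝ :=
    koszulForm (E := E) (metricInChart p) (chartAt E p p) w
  InnerProductSpace.continuousLinearMapOfBilin B

/-- The Levi-Civita covariant derivative `v ↦ ∇_v Y` at `x` of a vector field `Y`: in coordinates
`∇_v Y = DY v + Γ(v, Y)`. -/
def covDeriv (Y : ∀ x : N, TangentSpace 𝓘(ℝ, E) x) (x : N) :
    TangentSpace 𝓘(ℝ, E) x →L[ℝ] TangentSpace 𝓘(ℝ, E) x :=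
  let D : TangentSpace 𝓘(ℝ, E) x →L[ℝ] E := mvfderiv 𝓘(ℝ, E) (fun y ↦ coord x y (Y y)) x
  (coordInv x x).comp D + christoffel x (Y x)

/-- The Riemannian gradient: `⟪grad f x, w⟫ = df(x) w`. -/
def grad (f : N → ℝ) (x : N) : TangentSpace 𝓘(ℝ, E) x :=
  riesz x (mvfderiv 𝓘(ℝ, E) f x)

/-- The Riemannian Hessian `Hess f(x)[h] = ∇_h grad f`, a linear map of the tangent space at `x`. -/
def hess (f : N → ℝ) (x : N) : TangentSpace 𝓘(ℝ, E) x →L[ℝ] TangentSpace 𝓘(ℝ, E) x :=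
  covDeriv (grad f) x

/-- `f` is twice differentiable on `U`: it is differentiable at every point of `U`, and so is its
gradient field. -/
def TwiceDifferentiableOn (f : N → ℝ) (U : Set N) : Prop :=
  ∀ x ∈ U, MDifferentiableAt 𝓘(ℝ, E) 𝓘(ℝ, ℝ) f x ∧
    MDifferentiableAt 𝓘(ℝ, E) (𝓘(ℝ, E).prod 𝓘(ℝ, E))
      (fun y ↦ (⟨y, grad f y⟩ : TangentBundle 𝓘(ℝ, E) N)) x

/-- The velocity of a curve parametrized by `[0, 1]`. -/
def velocity (γ : ℝ → N) (t : ℝ) : TangentSpace 𝓘(ℝ, E) (γ t) :=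
  mfderivWithin 𝓘(ℝ, ℝ) 𝓘(ℝ, E) γ (Icc 0 1) t (1 : ℝ)

/-- The covariant derivative at time `t` of a vector field `V` along a curve `γ : [0, 1] → N`:
in coordinates `V' + Γ(γ', V)`. -/
def covDerivAlong (γ : ℝ → N) (V : ∀ t, TangentSpace 𝓘(ℝ, E) (γ t)) (t : ℝ) :
    TangentSpace 𝓘(ℝ, E) (γ t) :=
  coordInv (γ t) (γ t) (derivWithin (fun s ↦ coord (E := E) (γ t) (γ s) (V s)) (Icc 0 1) t) +
    christoffel (γ t) (V t) (velocity γ t)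

variable (E) in
/-- `γ : [0, 1] → N` is a geodesic (affinely parametrized). -/
def IsGeodesic (γ : ℝ → N) : Prop :=
  ContMDiffOn 𝓘(ℝ, ℝ) 𝓘(ℝ, E) 2 γ (Icc 0 1) ∧
    ∀ t ∈ Icc (0 : ℝ) 1, covDerivAlong (E := E) γ (velocity γ) t = 0

/-- `V` is a parallel vector field along `γ : [0, 1] → N`. -/
def IsParallel (γ : ℝ → N) (V : ∀ t, TangentSpace 𝓘(ℝ, E) (γ t)) : Prop :=
  ContMDiffOn 𝓘(ℝ, ℝ) (𝓘(ℝ, E).prod 𝓘(ℝ, E)) 1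
      (fun t ↦ (⟨γ t, V t⟩ : TangentBundle 𝓘(ℝ, E) N)) (Icc 0 1) ∧
    ∀ t ∈ Icc (0 : ℝ) 1, covDerivAlong γ V t = 0

open Classical in
/-- Parallel transport along `γ` from time `a` to time `b`, with `a, b ∈ [0, 1]`. -/
def parallelTransport (γ : ℝ → N) (a b : ℝ) (v : TangentSpace 𝓘(ℝ, E) (γ a)) :
    TangentSpace 𝓘(ℝ, E) (γ b) :=
  if h : ∃ V : ∀ t, TangentSpace 𝓘(ℝ, E) (γ t), IsParallel γ V ∧ V a = v then h.choose b else 0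

/-- The curve `γ : [0, 1] → N` is a geodesic with `γ 0 = x` and initial velocity `v`. -/
def IsGeodesicFrom (x : N) (v : TangentSpace 𝓘(ℝ, E) x) (γ : ℝ → N) : Prop :=
  IsGeodesic E γ ∧
    (⟨γ 0, velocity γ 0⟩ : TangentBundle 𝓘(ℝ, E) N) = ⟨x, v⟩

/-- The domain of the exponential map at `x`. -/
def expDomain (x : N) : Set (TangentSpace 𝓘(ℝ, E) x) :=
  {v | ∃ γ : ℝ → N, IsGeodesicFrom x v γ}

open Classical in
/-- The exponential map at `x` (with the value `x` outside of its domain). -/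
def expMap (x : N) (v : TangentSpace 𝓘(ℝ, E) x) : N :=
  if h : ∃ γ : ℝ → N, IsGeodesicFrom x v γ then h.choose 1 else x

variable (E) in
/-- Any two points of `U` are joined by a geodesic that stays in `U`. -/
def GeodesicallyConvex (U : Set N) : Prop :=
  ∀ x ∈ U, ∀ y ∈ U, ∃ v ∈ expDomain (E := E) x, expMap x v = y ∧
    ∀ t ∈ Icc (0 : ℝ) 1, expMap x (t • v) ∈ U

/-- The Lipschitz condition with constant `L` at `x` for the Hessian of `f` on `U`: for every
geodesic `γ(t) = exp_x(t Δx)`, `0 ≤ t ≤ 1`, in `U`, the operator norm satisfies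
`‖P_{1,0} Hess f(exp_x(Δx)) P_{0,1} - Hess f(x)‖ ≤ L ‖Δx‖`. Here `γ 0 = x`. -/
def HessLipschitzAt (f : N → ℝ) (U : Set N) (L : ℝ) (x : N) : Prop :=
  ∀ Δx ∈ expDomain (E := E) x,
    let γ : ℝ → N := fun t ↦ expMap x (t • Δx)
    (∀ t ∈ Icc (0 : ℝ) 1, γ t ∈ U) →
      ∀ h : TangentSpace 𝓘(ℝ, E) (γ 0),
        ‖parallelTransport γ 1 0 (hess f (γ 1) (parallelTransport γ 0 1 h)) - hess f (γ 0) h‖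
          ≤ L * ‖Δx‖ * ‖h‖

end

end RiemannianOpt

end

/-! In the preferred chart at `xhat`, let `F` be `f`, `g_u` the Gram form of the metric and `Y` the
gradient, all in coordinates. Near the base point `u₀` one has `dF(u) = g_u(Y u, ·)`. At a critical
point `Y u₀ = 0`, so the Christoffel term, linear in `Y`, drops out of the Hessian. For the same
reason the derivative of `g_u` does not enter when `dF` is differentiated at `u₀`. Hence the second
derivative of `F` at `u₀` is `g_{u₀}(DY ·, ·)`, the Hessian form
(`exists_secondDeriv_comp_chart_symm`). Both claims thereby become second order tests in the Banach
space `E`, valid when `F'` is differentiable merely at `u₀`: `secondDeriv_nonneg_of_isLocalMin` and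
`isLocalMin_of_secondDeriv_coercive`. For the first, a minimizer is critical; for the second,
`exists_norm_model_le` carries coercivity from the Riemannian norm to the norm of `E`. -/

namespace RiemannianOpt

/-! ### Second order tests and a product rule in normed spaces -/

section SecondOrderTests

variable {E : Type*} [NormedAddCommGroup E] [NormedSpace ℝ E]
  {F : E → ℝ} {F' : E → E →L[ℝ] ℝ} {F'' : E →L[ℝ] E →L[ℝ] ℝ} {u₀ : E}

/-- Second order necessary condition for a local minimum, when the derivative is differentiable at
the minimizer. -/
theorem secondDeriv_nonneg_of_isLocalMin (hF : ∀ᶠ u in 𝓝 u₀, HasFDerivAt F (F' u) u)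
    (hF' : HasFDerivAt F' F'' u₀) (hmin : IsLocalMin F u₀) (h : E) : 0 ≤ F'' h h := by
  by_contra! hneg
  have h0 : F' u₀ = 0 := hmin.hasFDerivAt_eq_zero hF.self_of_nhds
  have hline : ∀ t : ℝ, HasDerivAt (fun t : ℝ ↦ u₀ + t • h) h t := fun t ↦ by
    simpa using ((hasDerivAt_id t).smul_const h).const_add u₀
  have hlim : Filter.Tendsto (fun t : ℝ ↦ u₀ + t • h) (𝓝 0) (𝓝 u₀) := by
    simpa using (hline 0).continuousAt.tendsto
  have hd : HasDerivAt (fun t : ℝ ↦ F' (u₀ + t • h) h) (F'' h h) 0 := by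
    have h1 : HasFDerivAt F' F'' (u₀ + (0 : ℝ) • h) := by simpa using hF'
    have h2 := h1.comp_hasDerivAt (0 : ℝ) (hline 0)
    simpa using h2.clm_apply (hasDerivAt_const (0 : ℝ) h)
  -- `t ↦ F' (u₀ + t • h) h` vanishes at `0` with negative derivative, so it is negative for small
  -- `t > 0`; by the mean value theorem `F` then drops below `F u₀`.
  have hslope : ∀ᶠ t in 𝓝[≠] (0 : ℝ), slope (fun t : ℝ ↦ F' (u₀ + t • h) h) 0 t < 0 :=
    (hasDerivAt_iff_tendsto_slope.1 hd).eventually_lt_const hneg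
  obtain ⟨δ, hδ, hball⟩ := Metric.eventually_nhds_iff.1
    ((hlim.eventually hF).and ((hlim.eventually hmin).and (eventually_nhdsWithin_iff.1 hslope)))
  have hmem : ∀ t ∈ Icc 0 (δ / 2), dist t 0 < δ := fun t ht ↦ by
    rw [Real.dist_eq, sub_zero, abs_of_nonneg ht.1]
    linarith [ht.2]
  have hder : ∀ t ∈ Icc 0 (δ / 2), HasDerivAt (fun t : ℝ ↦ F (u₀ + t • h)) (F' (u₀ + t • h) h) t :=
    fun t ht ↦ (hball (hmem t ht)).1.comp_hasDerivAt t (hline t)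
  obtain ⟨s, hs, hs'⟩ := exists_hasDerivAt_eq_slope (fun t : ℝ ↦ F (u₀ + t • h))
    (fun t ↦ F' (u₀ + t • h) h) (half_pos hδ)
    (fun t ht ↦ (hder t ht).continuousAt.continuousWithinAt)
    (fun t ht ↦ hder t (Ioo_subset_Icc_self ht))
  have hneg' := (hball (hmem s (Ioo_subset_Icc_self hs))).2.2 hs.1.ne'
  simp only [slope_def_field, zero_smul, add_zero, h0, zero_apply,
    sub_zero] at hneg'
  have hge := (hball (hmem (δ / 2) ⟨(half_pos hδ).le, le_rfl⟩)).2.1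
  have hlt : F' (u₀ + s • h) h < 0 := by
    by_contra! hcon
    exact hneg'.not_ge (div_nonneg hcon hs.1.le)
  rw [hs'] at hlt
  refine hlt.not_ge (div_nonneg ?_ (by linarith))
  simpa using hge

/-- Second order sufficient condition for a local minimum, when the derivative is differentiable at
the critical point. -/
theorem isLocalMin_of_secondDeriv_coercive (hF : ∀ᶠ u in 𝓝 u₀, HasFDerivAt F (F' u) u)
    (hF' : HasFDerivAt F' F'' u₀) (h0 : F' u₀ = 0) {c : ℝ} (hc : 0 < c)
    (hcoer : ∀ h, c * ‖h‖ ^ 2 ≤ F'' h h) : IsLocalMin F u₀ := by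
  -- With the coercivity constant `c` as tolerance, the error `c * ‖w‖ ^ 2` in `F' (u₀ + w) w` is
  -- absorbed by `F'' w w`.
  obtain ⟨δ, hδ, hball⟩ := Metric.eventually_nhds_iff_ball.1 (hF.and (hF'.isLittleO.def hc))
  filter_upwards [Metric.ball_mem_nhds u₀ hδ] with u hu
  have hseg : segment ℝ u₀ u ⊆ Metric.ball u₀ δ :=
    (convex_ball u₀ δ).segment_subset (Metric.mem_ball_self hδ) hu
  obtain ⟨z, hz, hzeq⟩ := domain_mvt
    (fun x hx ↦ (hball x (hseg hx)).1.hasFDerivWithinAt (s := segment ℝ u₀ u))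
    (convex_segment u₀ u) (left_mem_segment ℝ u₀ u) (right_mem_segment ℝ u₀ u)
  have hbound := (hball z (hseg hz)).2
  rw [segment_eq_image'] at hz
  obtain ⟨θ, hθ, rfl⟩ := hz
  -- The mean value point may be the endpoint `u₀`, where `F'` vanishes and `F u = F u₀`.
  rcases hθ.1.eq_or_lt with rfl | hθpos
  · simp only [zero_smul, add_zero, h0, zero_apply] at hzeq
    linarith
  · simp only [h0, sub_zero, add_sub_cancel_left] at hbound
    set w := θ • (u - u₀) with hw
    have h1 := (F' (u₀ + w) - F'' w).le_opNorm w
    have h2 : ‖F' (u₀ + w) - F'' w‖ * ‖w‖ ≤ c * ‖w‖ * ‖w‖ := by gcongr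
    have h3 := neg_le_of_abs_le ((Real.norm_eq_abs _).symm.le.trans (h1.trans h2))
    rw [sub_apply] at h3
    have h4 : 0 ≤ F' (u₀ + w) w := by nlinarith [hcoer w]
    have h5 : F' (u₀ + w) w = θ * F' (u₀ + w) (u - u₀) := by
      conv_lhs => rw [hw, map_smul, smul_eq_mul, ← hw]
    have h6 : 0 ≤ F' (u₀ + w) (u - u₀) := nonneg_of_mul_nonneg_right (h5 ▸ h4) hθpos
    linarith

/-- Product rule for a continuous family of operators applied to a function vanishing at the base
point. -/
theorem hasFDerivAt_clm_apply_of_eq_zero {G H : Type*} [NormedAddCommGroup G] [NormedSpace ℝ G]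
    [NormedAddCommGroup H] [NormedSpace ℝ H] {B : E → G →L[ℝ] H} {Y : E → G} {Y' : E →L[ℝ] G}
    (hB : ContinuousAt B u₀) (hY : HasFDerivAt Y Y' u₀) (h0 : Y u₀ = 0) :
    HasFDerivAt (fun u ↦ B u (Y u)) ((B u₀).comp Y') u₀ := by
  refine .of_isLittleO ?_
  -- Since `Y u = O(u - u₀)`, continuity of `B` alone makes `(B u - B u₀) (Y u)` negligible.
  have hsub : Y =O[𝓝 u₀] fun u ↦ u - u₀ := by simpa [h0] using hY.isBigO_sub
  have h1 : (fun u ↦ (B u - B u₀) (Y u)) =o[𝓝 u₀] fun u ↦ u - u₀ := by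
    have hB' : (fun u ↦ B u - B u₀) =o[𝓝 u₀] fun _ ↦ (1 : ℝ) :=
      (Asymptotics.isLittleO_one_iff ℝ).2 (by simpa using hB.tendsto.sub_const (B u₀))
    have h2 : (fun u ↦ ‖B u - B u₀‖ * ‖Y u‖) =o[𝓝 u₀] fun u ↦ (1 : ℝ) * ‖u - u₀‖ :=
      hB'.norm_left.mul_isBigO hsub.norm_norm
    simp only [one_mul] at h2
    refine (Asymptotics.IsBigO.of_bound 1 (.of_forall fun u ↦ ?_)).trans_isLittleO h2.of_norm_right
    simpa using (B u - B u₀).le_opNorm (Y u)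
  have h2 : (fun u ↦ B u₀ (Y u - Y u₀ - Y' (u - u₀))) =o[𝓝 u₀] fun u ↦ u - u₀ :=
    ((B u₀).isBigO_comp _ _).trans_isLittleO hY.isLittleO
  refine (h1.add h2).congr_left fun u ↦ ?_
  simp [h0]

end SecondOrderTests

/-- The inverse chart is a local homeomorphism, so it maps the neighbourhood filter of the
coordinate point to that of `p`. -/
theorem isLocalMin_iff_comp_chart_symm {E : Type*} [TopologicalSpace E] {N : Type*}
    [TopologicalSpace N] [ChartedSpace E N] {f : N → ℝ} {p : N} :
    IsLocalMin f p ↔ IsLocalMin (fun u ↦ f ((chartAt E p).symm u)) (chartAt E p p) := by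
  have hp := (chartAt E p).left_inv (mem_chart_source E p)
  have hmap := (chartAt E p).symm.map_nhds_eq (mem_chart_target E p)
  rw [hp] at hmap
  simp only [IsLocalMin, IsMinFilter, hp]
  rw [← hmap, Filter.eventually_map]

/-! ### Gradient, metric and Hessian in the preferred chart -/

section Coordinates

variable {E : Type*} [NormedAddCommGroup E] [NormedSpace ℝ E]
  {N : Type*} [TopologicalSpace N] [ChartedSpace E N] [IsManifold 𝓘(ℝ, E) ∞ N]

theorem koszulForm_zero_apply (g : E → E →L[ℝ] E →L[ℝ] ℝ) (u v z : E) :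
    koszulForm g u 0 v z = 0 := by
  rw [koszulForm_apply]
  generalize fderiv ℝ g u = D
  simp only [ContinuousLinearMap.map_zero, zero_apply, add_zero, sub_zero, mul_zero]

theorem coordInv_coord {p y : N} (hy : y ∈ (chartAt E p).source) (v : TangentSpace 𝓘(ℝ, E) y) :
    coordInv p y (coord p y v) = v :=
  (trivializationAt E (TangentSpace 𝓘(ℝ, E)) p).symmL_continuousLinearMapAt (R := ℝ) hy v

theorem coord_self_apply (p : N) (v : E) : coord (E := E) p p v = v := by
  have h := TangentBundle.continuousLinearMapAt_trivializationAt (I := 𝓘(ℝ, E))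
    (mem_chart_source E p)
  rw [mfderiv_extChartAt_self] at h
  exact DFunLike.congr_fun h v

theorem coordInv_self_apply (p : N) (v : E) : coordInv (E := E) p p v = v := by
  have h := coordInv_coord (mem_chart_source E p) (v : TangentSpace 𝓘(ℝ, E) p)
  exact (congrArg (coordInv (E := E) p p) (coord_self_apply p v)).symm.trans h

/-- The derivative of a function read in the preferred chart around `p`. -/
theorem hasFDerivAt_comp_chart_symm {f : N → ℝ} {p : N} {u : E} (hu : u ∈ (chartAt E p).target)
    (hf : MDifferentiableAt 𝓘(ℝ, E) 𝓘(ℝ, ℝ) f ((chartAt E p).symm u)) :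
    HasFDerivAt (fun u ↦ f ((chartAt E p).symm u))
      ((mvfderiv 𝓘(ℝ, E) f ((chartAt E p).symm u)).comp
        (coordInv p ((chartAt E p).symm u))) u := by
  set y := (chartAt E p).symm u with hy
  have hys : y ∈ (chartAt E p).source := (chartAt E p).map_target hu
  have h1 := TangentBundle.symmL_trivializationAt (I := 𝓘(ℝ, E)) hys
  have huy : extChartAt 𝓘(ℝ, E) p y = u := by simp [hy, hu]
  have hsymm : MDifferentiableAt 𝓘(ℝ, E) 𝓘(ℝ, E) (extChartAt 𝓘(ℝ, E) p).symm u := by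
    have h := mdifferentiableWithinAt_extChartAt_symm (I := 𝓘(ℝ, E)) (x := p) (z := u)
      (by simpa using hu)
    rwa [modelWithCornersSelf_coe, range_id, mdifferentiableWithinAt_univ] at h
  let D : E →L[ℝ] TangentSpace 𝓘(ℝ, E) y := coordInv p y
  have hd : HasMFDerivAt 𝓘(ℝ, E) 𝓘(ℝ, E) (extChartAt 𝓘(ℝ, E) p).symm u D := by
    have h2 := hsymm.hasMFDerivAt
    rw [huy, modelWithCornersSelf_coe, range_id, mfderivWithin_univ] at h1
    exact (show D = _ from h1) ▸ h2
  have hf' : HasMFDerivAt 𝓘(ℝ, E) 𝓘(ℝ, ℝ) f ((extChartAt 𝓘(ℝ, E) p).symm u)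
    (mvfderiv 𝓘(ℝ, E) f y) := hf.hasMFDerivAt
  exact (hf'.comp u hd).hasFDerivAt

/-- The coordinates of a differentiable vector field, read in the preferred chart. -/
theorem hasFDerivAt_coord_comp_chart_symm {Y : ∀ x : N, TangentSpace 𝓘(ℝ, E) x} {p : N}
    (hY : MDifferentiableAt 𝓘(ℝ, E) (𝓘(ℝ, E).prod 𝓘(ℝ, E))
      (fun y ↦ (⟨y, Y y⟩ : TangentBundle 𝓘(ℝ, E) N)) p) :
    HasFDerivAt (𝕜 := ℝ) (E := E)
      (fun u ↦ coord (E := E) p ((chartAt E p).symm u) (Y ((chartAt E p).symm u)))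
      (mvfderiv 𝓘(ℝ, E) (fun y ↦ coord p y (Y y)) p) (chartAt E p p) := by
  have h1 : MDifferentiableAt 𝓘(ℝ, E) 𝓘(ℝ, E) (fun y ↦ coord (E := E) p y (Y y)) p := by
    refine ((mdifferentiableAt_totalSpace _ _).1 hY).2.congr_of_eventuallyEq ?_
    filter_upwards [(chartAt E p).open_source.mem_nhds (mem_chart_source E p)] with y hy
    exact Trivialization.continuousLinearMapAt_apply_of_mem ℝ _ hy _
  have h2 := h1.hasMFDerivAt.2
  simp only [modelWithCornersSelf_coe, range_id] at h2
  exact hasFDerivWithinAt_univ.1 h2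

variable [RiemannianBundle (fun x : N ↦ TangentSpace 𝓘(ℝ, E) x)]

theorem metricInChart_chart_apply {p y : N} (hy : y ∈ (chartAt E p).source) (a b : E) :
    metricInChart p (chartAt E p y) a b =
      inner ℝ (coordInv (E := E) p y a) (coordInv (E := E) p y b) := by
  have h : metricInChart p (chartAt E p y) a b =
    inner ℝ (coordInv (E := E) p ((chartAt E p).symm (chartAt E p y)) a)
      (coordInv (E := E) p ((chartAt E p).symm (chartAt E p y)) b) := rfl
  rw [h, (chartAt E p).left_inv hy]

/-- The Gram form in the preferred chart is continuous at the base point. -/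
theorem continuousAt_metricInChart
    [IsContMDiffRiemannianBundle 𝓘(ℝ, E) ∞ E (fun x : N ↦ TangentSpace 𝓘(ℝ, E) x)] (p : N) :
    ContinuousAt (metricInChart (E := E) p) (chartAt E p p) := by
  obtain ⟨g, g_smooth, hg⟩ := IsContMDiffRiemannianBundle.exists_contMDiff
    (IB := 𝓘(ℝ, E)) (n := ∞) (F := E) (E := fun x : N ↦ TangentSpace 𝓘(ℝ, E) x)
  have W := g_smooth.continuous.continuousAt (x := p)
  -- Continuity of a section of the bundle of forms is continuity of its expression in
  -- trivializations, which is the Gram form on the chart domain.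
  rw [continuousAt_hom_bundle] at W
  have hcomp := ContinuousAt.comp_of_eq W.2
    ((chartAt E p).continuousAt_symm (mem_chart_target E p))
    ((chartAt E p).left_inv (mem_chart_source E p))
  refine hcomp.congr ?_
  filter_upwards [(chartAt E p).open_target.mem_nhds (mem_chart_target E p)] with u hu
  have hy := (chartAt E p).map_target hu
  ext a b
  change ContinuousLinearMap.inCoordinates E (TangentSpace 𝓘(ℝ, E)) (E →L[ℝ] ℝ)
    (fun x : N ↦ TangentSpace 𝓘(ℝ, E) x →L[ℝ] ℝ) p ((chartAt E p).symm u) p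
    ((chartAt E p).symm u) (g ((chartAt E p).symm u)) a b = _
  rw [inCoordinates_apply_eq₂ hy hy (mem_univ _)]
  have h2 := metricInChart_chart_apply hy a b
  rw [(chartAt E p).right_inv hu, hg] at h2
  have hsymm : ∀ v : E, coordInv p ((chartAt E p).symm u) v =
      (trivializationAt E (TangentSpace 𝓘(ℝ, E)) p).symm ((chartAt E p).symm u) v :=
    Trivialization.symmL_apply _ hy
  rw [h2, hsymm, hsymm]
  simp

/-- The identification of a tangent space with the model space is bounded. -/
theorem exists_norm_model_le (p : N) :
    ∃ C > 0, ∀ h : TangentSpace 𝓘(ℝ, E) p, ‖coord p p h‖ ≤ C * ‖h‖ := by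
  -- The `+ 1` keeps the constant positive, so that it can be divided by.
  refine ⟨‖coord (E := E) p p‖ + 1, by positivity, fun h ↦ ?_⟩
  grw [(coord (E := E) p p).le_opNorm h]
  gcongr
  linarith

variable [CompleteSpace E]

theorem inner_riesz (x : N) (l : TangentSpace 𝓘(ℝ, E) x →L[ℝ] ℝ) (w : TangentSpace 𝓘(ℝ, E) x) :
    inner ℝ (riesz x l) w = l w := by
  have := completeSpace_tangentSpace (E := E) x
  exact InnerProductSpace.toDual_symm_apply

theorem inner_grad (f : N → ℝ) (x : N) (w : TangentSpace 𝓘(ℝ, E) x) :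
    inner ℝ (grad f x) w = mvfderiv 𝓘(ℝ, E) f x w :=
  inner_riesz x _ w

/-- Fermat's rule applies in the chart, and `coordInv p p` is onto the tangent space. -/
theorem grad_eq_zero_of_isLocalMin {f : N → ℝ} {p : N}
    (hf : MDifferentiableAt 𝓘(ℝ, E) 𝓘(ℝ, ℝ) f p)
    (hmin : IsLocalMin (fun u ↦ f ((chartAt E p).symm u)) (chartAt E p p)) :
    grad (E := E) f p = 0 := by
  have hp := (chartAt E p).left_inv (mem_chart_source E p)
  have h0 := hmin.hasFDerivAt_eq_zero
    (hasFDerivAt_comp_chart_symm (mem_chart_target E p) (by rwa [hp]))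
  rw [hp] at h0
  refine ext_inner_right ℝ fun w ↦ ?_
  rw [inner_grad, inner_zero_left, ← coordInv_coord (mem_chart_source E p) w]
  exact DFunLike.congr_fun h0 (coord p p w)

theorem christoffel_zero (p : N) : christoffel (E := E) p 0 = 0 := by
  have := completeSpace_tangentSpace (E := E) p
  ext v
  refine ext_inner_right ℝ fun w ↦ ?_
  rw [zero_apply, inner_zero_left]
  refine (InnerProductSpace.continuousLinearMapOfBilin_apply _ v w).trans ?_
  exact koszulForm_zero_apply (metricInChart p) (chartAt E p p) v w

/-- The Christoffel term is linear in the field and vanishes with it. -/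
theorem hess_apply_of_grad_eq_zero {f : N → ℝ} {p : N} (h0 : grad (E := E) f p = 0)
    (h : TangentSpace 𝓘(ℝ, E) p) :
    hess f p h = coordInv p p (mvfderiv 𝓘(ℝ, E) (fun y ↦ coord p y (grad f y)) p h) := by
  simp only [hess, covDeriv, h0, christoffel_zero, add_zero]
  rfl

/-- At a critical point of a twice differentiable function, the second derivative in the preferred
chart is the Riemannian Hessian. -/
theorem exists_secondDeriv_comp_chart_symm
    [IsContMDiffRiemannianBundle 𝓘(ℝ, E) ∞ E (fun x : N ↦ TangentSpace 𝓘(ℝ, E) x)]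
    {f : N → ℝ} {p : N} (hf : ∀ᶠ y in 𝓝 p, MDifferentiableAt 𝓘(ℝ, E) 𝓘(ℝ, ℝ) f y)
    (hgrad : MDifferentiableAt 𝓘(ℝ, E) (𝓘(ℝ, E).prod 𝓘(ℝ, E))
      (fun y ↦ (⟨y, grad f y⟩ : TangentBundle 𝓘(ℝ, E) N)) p)
    (h0 : grad (E := E) f p = 0) :
    ∃ (F' : E → E →L[ℝ] ℝ) (F'' : E →L[ℝ] E →L[ℝ] ℝ),
      (∀ᶠ u in 𝓝 (chartAt E p p), HasFDerivAt (fun u ↦ f ((chartAt E p).symm u)) (F' u) u) ∧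
      HasFDerivAt F' F'' (chartAt E p p) ∧ F' (chartAt E p p) = 0 ∧
      ∀ h : TangentSpace 𝓘(ℝ, E) p, F'' h h = inner ℝ (hess f p h) h := by
  have hp := (chartAt E p).left_inv (mem_chart_source E p)
  let Y : E → E := fun u ↦ coord p ((chartAt E p).symm u) (grad f ((chartAt E p).symm u))
  let Y' : E →L[ℝ] E := mvfderiv 𝓘(ℝ, E) (fun y ↦ coord p y (grad f y)) p
  have hY0 : Y (chartAt E p p) = 0 := by
    simp only [Y]
    rw [hp, h0, map_zero]
  have hY : HasFDerivAt Y Y' (chartAt E p p) := hasFDerivAt_coord_comp_chart_symm hgrad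
  refine ⟨fun u ↦ metricInChart p u (Y u), (metricInChart p (chartAt E p p)).comp Y', ?_,
    hasFDerivAt_clm_apply_of_eq_zero (continuousAt_metricInChart p) hY hY0, ?_, fun h ↦ ?_⟩
  · have hlim : Filter.Tendsto (chartAt E p).symm (𝓝 (chartAt E p p)) (𝓝 p) := by
      have := (chartAt E p).continuousAt_symm (mem_chart_target E p)
      rwa [ContinuousAt, hp] at this
    filter_upwards [hlim.eventually hf,
      (chartAt E p).open_target.mem_nhds (mem_chart_target E p)] with u hfu hu
    have hy := (chartAt E p).map_target hu
    have heq : metricInChart p u (Y u) = (mvfderiv 𝓘(ℝ, E) f ((chartAt E p).symm u)).comp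
        (coordInv p ((chartAt E p).symm u)) := by
      ext w
      have h1 := metricInChart_chart_apply hy (Y u) w
      rw [(chartAt E p).right_inv hu, coordInv_coord hy, inner_grad] at h1
      exact h1
    exact heq ▸ hasFDerivAt_comp_chart_symm hu hfu
  · simp only [hY0, map_zero]
  -- The tangent space at `p` is `E` as a vector space, and `coordInv p p` is the identity, so `h`
  -- is its own coordinate vector.
  · let k : E := h
    have h1 := metricInChart_chart_apply (mem_chart_source E p) (Y' k) k
    rw [coordInv_self_apply p k] at h1
    rw [hess_apply_of_grad_eq_zero h0]
    exact h1

end Coordinates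

end RiemannianOpt

/-! The derivative of `f` in the preferred chart is differentiable at `xhat`, and its derivative there
is the Hessian. This already gives the sufficient condition: neither the Lipschitz condition nor the
convexity of `U` is needed. -/

theorem theorem2p5
    {E : Type*} [NormedAddCommGroup E] [NormedSpace ℝ E] [CompleteSpace E]
    {N : Type*} [TopologicalSpace N] [T2Space N] [ChartedSpace E N] [IsManifold 𝓘(ℝ, E) ∞ N]
    [RiemannianBundle (fun x : N ↦ TangentSpace 𝓘(ℝ, E) x)]
    [IsContMDiffRiemannianBundle 𝓘(ℝ, E) ∞ E (fun x : N ↦ TangentSpace 𝓘(ℝ, E) x)]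
    (U : Set N) (hUopen : IsOpen U) (hUconv : RiemannianOpt.GeodesicallyConvex E U)
    (f : N → ℝ) (hf : RiemannianOpt.TwiceDifferentiableOn (E := E) f U)
    (xhat : N) (hxhat : xhat ∈ U) :
    (IsLocalMinOn f U xhat →
      ∀ h : TangentSpace 𝓘(ℝ, E) xhat, 0 ≤ inner ℝ (RiemannianOpt.hess f xhat h) h) ∧
    (RiemannianOpt.grad (E := E) f xhat = 0 →
      (∃ c > 0, ∀ h : TangentSpace 𝓘(ℝ, E) xhat,
        c * ‖h‖ ^ 2 ≤ inner ℝ (RiemannianOpt.hess f xhat h) h) →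
      (∃ L : ℝ, RiemannianOpt.HessLipschitzAt (E := E) f U L xhat) →
      IsLocalMinOn f U xhat) := by
  have hUnhds : U ∈ 𝓝 xhat := hUopen.mem_nhds hxhat
  have hd : ∀ᶠ y in 𝓝 xhat, MDifferentiableAt 𝓘(ℝ, E) 𝓘(ℝ, ℝ) f y := by
    filter_upwards [hUnhds] with y hy using (hf y hy).1
  have hgrad := (hf xhat hxhat).2
  refine ⟨fun hmin ↦ ?_, fun h0 ⟨c, hc, hcoer⟩ _ ↦ ?_⟩
  · have hmin' := RiemannianOpt.isLocalMin_iff_comp_chart_symm (E := E).1 (hmin.isLocalMin hUnhds)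
    obtain ⟨F', F'', hF, hF', -, hhess⟩ := RiemannianOpt.exists_secondDeriv_comp_chart_symm hd hgrad
      (RiemannianOpt.grad_eq_zero_of_isLocalMin (hf xhat hxhat).1 hmin')
    intro h
    rw [← hhess h]
    exact RiemannianOpt.secondDeriv_nonneg_of_isLocalMin hF hF' hmin' h
  · obtain ⟨F', F'', hF, hF', hF0, hhess⟩ :=
      RiemannianOpt.exists_secondDeriv_comp_chart_symm hd hgrad h0
    obtain ⟨C, hC, hCle⟩ := RiemannianOpt.exists_norm_model_le (E := E) xhat
    -- The norm of `E` is at most `C` times the Riemannian norm, which turns the constant `c` into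
    -- `c / C ^ 2`.
    refine IsLocalMin.on (RiemannianOpt.isLocalMin_iff_comp_chart_symm (E := E).2
      (RiemannianOpt.isLocalMin_of_secondDeriv_coercive hF hF' hF0 (c := c / C ^ 2)
        (by positivity) fun h ↦ ?_)) U
    -- The same vector as `h`, but measured in the Riemannian norm.
    let v : TangentSpace 𝓘(ℝ, E) xhat := h
    have h1 : ‖h‖ ≤ C * ‖v‖ := by
      have := hCle v
      rwa [RiemannianOpt.coord_self_apply xhat h] at this
    have h2 : ‖h‖ ^ 2 ≤ (C * ‖v‖) ^ 2 := by gcongr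
    calc c / C ^ 2 * ‖h‖ ^ 2 ≤ c / C ^ 2 * (C * ‖v‖) ^ 2 := by gcongr
      _ = c * ‖v‖ ^ 2 := by field_simp
      _ ≤ F'' h h := (hcoer v).trans_eq (hhess v).symm
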